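/- **Conventions.** $\mathfrak L^{n}$ denotes the set of linear differential behaviors with $n$ variables, i.e. of sets $\mathfrak B=\{w\in C^\infty(\mathbb R,\mathbb R^{n}) : R(\tfrac{d}{dt})w=0\}$ with $R\in\mathbb R^{g\times n}[\xi]$, $g\ge 1$. A set of components of $w$ is *free* in $\mathfrak B$ if these components can be prescribed as an arbitrary smooth signal and completed to an element of $\mathfrak B$; an *input-output partition* takes a maximal free set of components as inputs and the other components as outputs. The number of outputs does not depend on the partition and is denoted $\mathtt p(\mathfrak B)$. A subscript such as $(\cdot)_w$ or $(\cdot)_{(w,c)}$ denotes the manifest behavior, i.e. the projection onto the indicated variables. **Setting.** Let $\mathcal P_i\in\mathfrak L^{\mathtt w_i+\mathtt s_i+\mathtt c_i}$ and $\mathcal K_i\in\mathfrak L^{\mathtt w_i+\mathtt k_i}$, $i=1,\dots,L$. Here $s_i$ is composed of variables $s_{ij}$, $j\ne i$ (possibly of dimension $0$), shared by the plants $i$ and $j$, so that $s_{ij}=s_{ji}$; likewise $k_i$ is composed of $k_{ij}=k_{ji}$, $j\neq i$. Put $$\mathcal P_{\mathcal I}=\{(w,s,c) : (w_i,s_i,c_i)\in\mathcal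 P_i \text{ for all } i\},\qquad \mathcal K_{\mathcal I}=\{(w,k) : (w_i,k_i)\in\mathcal K_i\text{ for all } i\},$$ $$\mathcal N(\mathcal P_{\mathcal I})=\{w : (w,0)\in(\mathcal P_{\mathcal I})_{(w,c)}\}.$$ The local canonical controllers are $$\mathcal C_i^{\rm can}=\{(c_i,s_i,k_i) : \exists\, w_i \text{ such that } (w_i,s_i,c_i)\in\mathcal P_i \text{ and } (w_i,k_i)\in\mathcal K_i\},$$ and the canonical distributed controller is their interconnection through the variables $(s_{ij},k_{ij})$, $$\mathcal C_{\mathcal I}^{\rm can}=\{(c,s,k) : (c_i,s_i,k_i)\in\mathcal C_i^{\rm can}\text{ for all } i\}.$$ **Statement.** Assume that $\mathcal N(\mathcal P_{\mathcal I})\subseteq(\mathcal K_{\mathcal I})_w\subseteq(\mathcal P_{\mathcal I})_w$ and that $(\mathcal P_{\mathcal I})_c=C^\infty(\mathbb R,\mathbb R^{\mathtt c})$, where $\mathtt c=\sum_i\mathtt c_i$. Then: 1. The canonical distributed controller implements $\mathcal K_{\mathcal I}$: each $\mathcal C_i^{\rm can}$ is a linear differential behavior, and $(\mathcal K_{\mathcal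 I})_w=(\mathcal P_{\mathcal I}\wedge_c\mathcal C_{\mathcal I}^{\rm can})_w$, where $\wedge_c$ is the interconnection that shares the variable $c$ only (the variables $s$ of the plant and of the controller are not identified with each other). 2. It is regular with respect to $c$: the behaviors $(\mathcal P_{\mathcal I})_{(w,c)}$ and $(\mathcal C_{\mathcal I}^{\rm can})_c$ are linear differential behaviors, and $$\mathtt p\big((\mathcal P_{\mathcal I})_{(w,c)}\wedge_c(\mathcal C_{\mathcal I}^{\rm can})_c\big)=\mathtt p\big((\mathcal P_{\mathcal I})_{(w,c)}\big)+\mathtt p\big((\mathcal C_{\mathcal I}^{\rm can})_c\big),$$ where $(\mathcal P_{\mathcal I})_{(w,c)}\wedge_c(\mathcal C_{\mathcal I}^{\rm can})_c=\{(w,c)\in(\mathcal P_{\mathcal I})_{(w,c)} : c\in(\mathcal C_{\mathcal I}^{\rm can})_c\}$. -/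

import Mathlib

open Polynomial
open scoped ContDiff

namespace Behavioral

/-! ### Signals and behaviors with time axis `ℝ` -/

/-- Signals `ℝ → ℝ^ι`, with components labelled by `ι`. -/
abbrev Signal (ι : Type) : Type := ℝ → ι → ℝ

/-- The components of `w` selected by `f`. -/
def select {α ι : Type} (f : α → ι) (w : Signal ι) : Signal α := fun t a => w t (f a)

/-- The combined signal `(v, w)`. -/
def pair {α β : Type} (v : Signal α) (w : Signal β) : Signal (α ⊕ β) :=
  fun t => Sum.elim (v t) (w t)

/-- A behavior: a set of signals. -/
abbrev Behavior (ι : Type) : Type := Set (Signal ι)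

/-- The behavior `C^∞(ℝ, ℝ^ι)`. -/
def smooth (ι : Type) [Fintype ι] : Behavior ι := {w | ContDiff ℝ ∞ w}

/-- The scalar differential operator `p(d/dt)` applied to `f`, evaluated at `t`. -/
noncomputable def diffOp (p : ℝ[X]) (f : ℝ → ℝ) (t : ℝ) : ℝ :=
  p.sum fun n a => a * iteratedDeriv n f t

/-- The smooth solutions of `R(d/dt) w = 0`. -/
def kernelBehavior {g : ℕ} {ι : Type} [Fintype ι] (R : Matrix (Fin g) ι ℝ[X]) : Behavior ι :=
  {w | w ∈ smooth ι ∧ ∀ r t, ∑ j, diffOp (R r j) (fun τ => w τ j) t = 0}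

/-- `B` is (the behavior of) a linear differential system: it has a kernel representation. -/
def IsLinearDifferential {ι : Type} [Fintype ι] (B : Behavior ι) : Prop :=
  ∃ g : ℕ, 0 < g ∧ ∃ R : Matrix (Fin g) ι ℝ[X], B = kernelBehavior R

/-- The manifest behavior of `B` with respect to the variables selected by `f`
(all other variables are eliminated). -/
def manifest {α ι : Type} (f : α → ι) (B : Behavior ι) : Behavior α :=
  {v | ∃ x ∈ B, select f x = v}

/-! ### Inputs, outputs and regular interconnections -/

/-- The components in `I` are free in `B`: they can be prescribed as an arbitrary smooth signal. -/
def IsFree {ι : Type} (B : Behavior ι) (I : Finset ι) : Prop :=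
  ∀ u ∈ smooth I, ∃ w ∈ B, select (fun i : I => (i : ι)) w = u

/-- Taking the components in `I` as inputs and all others as outputs is an input-output partition:
the components in `I` are maximally free. -/
def IsInputOutputPartition {ι : Type} (B : Behavior ι) (I : Finset ι) : Prop :=
  Maximal (IsFree B) I

/-- The output cardinality: the number of outputs in an input-output partition. For linear
differential systems all input-output partitions have the same number of outputs, so that the
infimum below is over a singleton. -/
noncomputable def outputCard {ι : Type} [Fintype ι] (B : Behavior ι) : ℕ :=
  sInf {p | ∃ I : Finset ι, IsInputOutputPartition B I ∧ p = Fintype.card ι - I.card}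

/-- The interconnection, through the control variable `c`, of a plant with variables `(w, c)` and a
controller with variable `c`. -/
def controlledBy {ν γ : Type} (P : Behavior (ν ⊕ γ)) (C : Behavior γ) : Behavior (ν ⊕ γ) :=
  {x | x ∈ P ∧ select Sum.inr x ∈ C}

/-- The interconnection through `c` of two linear differential systems `P` and `C` is regular. -/
def IsRegularInterconnection {ν γ : Type} [Fintype ν] [Fintype γ]
    (P : Behavior (ν ⊕ γ)) (C : Behavior γ) : Prop :=
  IsLinearDifferential P ∧ IsLinearDifferential C ∧
    outputCard (controlledBy P C) = outputCard P + outputCard C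

/-! ### Interconnected systems

There are `L` subsystems. Every unordered pair `e = {i, j}` of distinct subsystems carries a shared
variable (`s_ij = s_ji`), whose components are labelled by a type `S e`; this type is empty if
nothing is shared. -/

/-- Unordered pairs of distinct subsystems. -/
abbrev Link (L : ℕ) : Type := {e : Sym2 (Fin L) // ¬ e.IsDiag}

/-- Labels of the components of `s_i`, which collects the variables that subsystem `i` shares with
the other subsystems. -/
abbrev LocalLinkVar {L : ℕ} (S : Link L → Type) (i : Fin L) : Type :=
  Σ e : {e : Link L // i ∈ e.1}, S e.1

/-- Labels of all components of the interconnection variables of the network. -/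
abbrev LinkVar {L : ℕ} (S : Link L → Type) : Type := Σ e : Link L, S e

/-- The variables of subsystem `i` among all interconnection variables. -/
def linkIncl {L : ℕ} (S : Link L → Type) (i : Fin L) : LocalLinkVar S i → LinkVar S :=
  fun a => ⟨a.1.1, a.2⟩

section Network

variable {L : ℕ} {W C : Fin L → Type} {S K Q : Link L → Type}

/-- The interconnected plant, with variables `(w, s, c)`:
`(w_i, s_i, c_i) ∈ P_i` for all `i`. -/
def plantNetwork (P : ∀ i, Behavior (W i ⊕ LocalLinkVar S i ⊕ C i)) :
    Behavior ((Σ i, W i) ⊕ LinkVar S ⊕ (Σ i, C i)) :=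
  {x | ∀ i, select (Sum.map (Sigma.mk i) (Sum.map (linkIncl S i) (Sigma.mk i))) x ∈ P i}

/-- The interconnection of systems with external variables `v_i` and shared variables `q_i`, with
variables `(v, q)`: `(v_i, q_i) ∈ B_i` for all `i`. It is used for the desired behaviors and for
the local controllers. -/
def network {V : Fin L → Type} (B : ∀ i, Behavior (V i ⊕ LocalLinkVar Q i)) :
    Behavior ((Σ i, V i) ⊕ LinkVar Q) :=
  {x | ∀ i, select (Sum.map (Sigma.mk i) (linkIncl Q i)) x ∈ B i}

/-- The manifest behavior `(P_I)_(w,c)` of the interconnected plant. -/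
def plantWC (P : ∀ i, Behavior (W i ⊕ LocalLinkVar S i ⊕ C i)) :
    Behavior ((Σ i, W i) ⊕ (Σ i, C i)) :=
  manifest (Sum.map id Sum.inr) (plantNetwork P)

/-- The manifest behavior `(P_I)_w` of the interconnected plant. -/
def plantW (P : ∀ i, Behavior (W i ⊕ LocalLinkVar S i ⊕ C i)) : Behavior (Σ i, W i) :=
  manifest Sum.inl (plantNetwork P)

/-- The manifest behavior `(P_I)_c` of the interconnected plant. -/
def plantC (P : ∀ i, Behavior (W i ⊕ LocalLinkVar S i ⊕ C i)) : Behavior (Σ i, C i) :=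
  manifest (fun a => Sum.inr (Sum.inr a)) (plantNetwork P)

/-- The hidden behavior `{w | (w, 0) ∈ (P_I)_(w,c)}` of the interconnected plant. -/
def hidden (P : ∀ i, Behavior (W i ⊕ LocalLinkVar S i ⊕ C i)) : Behavior (Σ i, W i) :=
  {w | pair w 0 ∈ plantWC P}

/-- The manifest behavior of an interconnection `network B` with respect to its external variables:
`(K_I)_w` for the desired behaviors and `(C_I)_c` for the local controllers. -/
def networkExt {V : Fin L → Type} (B : ∀ i, Behavior (V i ⊕ LocalLinkVar Q i)) :
    Behavior (Σ i, V i) :=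
  manifest Sum.inl (network B)

/-- The interconnection through `c` of the interconnected plant, with variables `(w, s, c)`, and the
interconnected controller, with variables `(c, q)`. Its variables are `(w, s, c, q)`. -/
def closedLoop (P : ∀ i, Behavior (W i ⊕ LocalLinkVar S i ⊕ C i))
    (D : ∀ i, Behavior (C i ⊕ LocalLinkVar Q i)) :
    Behavior (((Σ i, W i) ⊕ LinkVar S ⊕ (Σ i, C i)) ⊕ LinkVar Q) :=
  {x | select Sum.inl x ∈ plantNetwork P ∧
    select (Sum.map (fun a => Sum.inr (Sum.inr a)) id) x ∈ network D}

/-- The distributed controller with local controllers `D_i`, which are linear differential systems,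
implements the desired interconnected behavior `K_I`. -/
def Implements [∀ i, Fintype (C i)] [∀ e, Fintype (Q e)]
    (D : ∀ i, Behavior (C i ⊕ LocalLinkVar Q i))
    (P : ∀ i, Behavior (W i ⊕ LocalLinkVar S i ⊕ C i))
    (Kd : ∀ i, Behavior (W i ⊕ LocalLinkVar K i)) : Prop :=
  (∀ i, IsLinearDifferential (D i)) ∧
    networkExt Kd = manifest (fun a => Sum.inl (Sum.inl a)) (closedLoop P D)

/-- The distributed controller with local controllers `D_i` is regular with respect to `c`. -/
def IsRegularWrtC [∀ i, Fintype (W i)] [∀ i, Fintype (C i)]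
    (D : ∀ i, Behavior (C i ⊕ LocalLinkVar Q i))
    (P : ∀ i, Behavior (W i ⊕ LocalLinkVar S i ⊕ C i)) : Prop :=
  IsRegularInterconnection (plantWC P) (networkExt D)

/-- The interconnection through `w_i` of the local plant and the local desired behavior, with
variables `((w_i, s_i, c_i), k_i)`. -/
def localInterconnection {i : Fin L} (Pi : Behavior (W i ⊕ LocalLinkVar S i ⊕ C i))
    (Ki : Behavior (W i ⊕ LocalLinkVar K i)) :
    Behavior ((W i ⊕ LocalLinkVar S i ⊕ C i) ⊕ LocalLinkVar K i) :=
  {x | select Sum.inl x ∈ Pi ∧ select (Sum.map Sum.inl id) x ∈ Ki}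

/-- The position of the variables `(c_i, (s_i, k_i))` among `((w_i, s_i, c_i), k_i)`. The controllers
`i` and `j` share the variable `(s_ij, k_ij)`, with components labelled by `S e ⊕ K e`. -/
def canonicalIncl (i : Fin L) :
    C i ⊕ LocalLinkVar (fun e => S e ⊕ K e) i →
      (W i ⊕ LocalLinkVar S i ⊕ C i) ⊕ LocalLinkVar K i
  | Sum.inl a => Sum.inl (Sum.inr (Sum.inr a))
  | Sum.inr ⟨e, Sum.inl a⟩ => Sum.inl (Sum.inr (Sum.inl ⟨e, a⟩))
  | Sum.inr ⟨e, Sum.inr a⟩ => Sum.inr ⟨e, a⟩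

/-- The local canonical controllers: the manifest behaviors with respect to `(c_i, s_i, k_i)` of the
interconnections of `P_i` and `K_i` through `w_i`. -/
def canonicalController (P : ∀ i, Behavior (W i ⊕ LocalLinkVar S i ⊕ C i))
    (Kd : ∀ i, Behavior (W i ⊕ LocalLinkVar K i)) (i : Fin L) :
    Behavior (C i ⊕ LocalLinkVar (fun e => S e ⊕ K e) i) :=
  manifest (canonicalIncl i) (localInterconnection (P i) (Kd i))

end Network

end Behavioral

namespace Behavioral

/-! A behavior with kernel representation `R` depends only on the row module `N` of `R`, and it is
`Hom(ℝ[X]^ι / N, C^∞)`. Over `ℝ[X]`, `C^∞` is divisible, hence injective. Injectivity makes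
elimination of variables the contraction of `N` (`manifest_solutions`), so manifest behaviors are
again linear differential. The output cardinality is the rank of `N` (`outputCard_solutions`).

Regularity: `c` is free in the plant exactly when no nonzero element of the plant module involves
`c` alone. The plant and controller modules then meet trivially and their ranks add.

Implementation: a desired `w` is realized by letting the controller reproduce the plant's own `s`
and the `k` of the desired behavior. Conversely, the local controllers carry internal signals `w'`
that form a plant trajectory with the same `c` and also lie in `(K_I)_w`. Since `w - w'` is hidden,
it lies in `(K_I)_w`, and so does `w`. -/

/-! ### Surjectivity of nonzero constant-coefficient differential operators -/

/-- The smooth functions `ℝ → 𝕜`. -/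
def smoothFun (𝕜 : Type) [RCLike 𝕜] : Submodule 𝕜 (ℝ → 𝕜) where
  carrier := {f | ContDiff ℝ ∞ f}
  add_mem' {f g} (hf : ContDiff ℝ ∞ f) (hg : ContDiff ℝ ∞ g) := hf.add hg
  zero_mem' := (contDiff_const : ContDiff ℝ ∞ fun _ : ℝ => (0 : 𝕜))
  smul_mem' _ f (hf : ContDiff ℝ ∞ f) := contDiff_const.smul hf

theorem smoothFun.contDiff {𝕜 : Type} [RCLike 𝕜] (f : smoothFun 𝕜) :
    ContDiff ℝ ∞ (f : ℝ → 𝕜) := f.2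

theorem contDiff_deriv {𝕜 : Type} [RCLike 𝕜] {f : ℝ → 𝕜} (hf : ContDiff ℝ ∞ f) :
    ContDiff ℝ ∞ (deriv f) :=
  (contDiff_infty_iff_deriv.1 hf).2

theorem smoothFun.differentiable {𝕜 : Type} [RCLike 𝕜] (f : smoothFun 𝕜) :
    Differentiable ℝ (f : ℝ → 𝕜) :=
  (contDiff_infty_iff_deriv.1 f.2).1

/-- Differentiation of smooth functions. -/
noncomputable def derivOp (𝕜 : Type) [RCLike 𝕜] : Module.End 𝕜 (smoothFun 𝕜) where
  toFun f := ⟨deriv f, contDiff_deriv f.2⟩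
  map_add' f g := by
    ext t
    exact deriv_add (smoothFun.differentiable f t) (smoothFun.differentiable g t)
  map_smul' c f := by
    ext t
    exact deriv_const_smul c (smoothFun.differentiable f t)

theorem derivOp_pow_apply {𝕜 : Type} [RCLike 𝕜] (n : ℕ) (f : smoothFun 𝕜) (t : ℝ) :
    ((derivOp 𝕜 ^ n) f : ℝ → 𝕜) t = iteratedDeriv n f t := by
  induction n generalizing f with
  | zero => simp
  | succ n ih => rw [pow_succ, Module.End.mul_apply, ih, iteratedDeriv_succ']; rfl

/-- Variation of constants: `f' - z f = g` is solved by `f(t) = e^{zt} ∫₀ᵗ e^{-zs} g(s) ds`. -/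
theorem derivOp_sub_algebraMap_surjective (z : ℂ) :
    Function.Surjective (derivOp ℂ - algebraMap ℂ (Module.End ℂ (smoothFun ℂ)) z) := by
  intro g
  have hlin (a : ℂ) : ContDiff ℝ ∞ fun t : ℝ => Complex.exp (a * t) :=
    (contDiff_const.mul Complex.ofRealCLM.contDiff).cexp
  have hh : ContDiff ℝ ∞ fun t : ℝ => Complex.exp (-z * t) * (g : ℝ → ℂ) t := (hlin _).mul g.2
  set h : ℝ → ℂ := fun t : ℝ => Complex.exp (-z * t) * (g : ℝ → ℂ) t with hdef
  have hH (t : ℝ) : HasDerivAt (fun t => ∫ s in (0 : ℝ)..t, h s) (h t) t :=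
    intervalIntegral.integral_hasDerivAt_right (hh.continuous.intervalIntegrable _ _)
      hh.continuous.stronglyMeasurable.stronglyMeasurableAtFilter hh.continuous.continuousAt
  have hHs : ContDiff ℝ ∞ fun t => ∫ s in (0 : ℝ)..t, h s := by
    refine contDiff_infty_iff_deriv.2 ⟨fun t => (hH t).differentiableAt, ?_⟩
    rwa [funext fun t => (hH t).deriv]
  refine ⟨⟨fun t => Complex.exp (z * t) * ∫ s in (0 : ℝ)..t, h s, (hlin z).mul hHs⟩, ?_⟩
  ext t
  have he : HasDerivAt (fun t : ℝ => Complex.exp (z * t)) (Complex.exp (z * t) * z) t := by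
    have : HasDerivAt (fun t : ℝ => z * (t : ℂ)) z t := by
      simpa using (Complex.ofRealCLM.hasDerivAt (x := t)).const_mul z
    exact this.cexp
  have hd := (he.mul (hH t)).deriv
  have hexp : Complex.exp (z * t) * Complex.exp (-z * t) = 1 := by
    rw [← Complex.exp_add]; simp
  change deriv (fun t : ℝ => Complex.exp (z * t) * ∫ s in (0 : ℝ)..t, h s) t
    - z * (Complex.exp (z * t) * ∫ s in (0 : ℝ)..t, h s) = _
  rw [show (fun t : ℝ => Complex.exp (z * t) * ∫ s in (0 : ℝ)..t, h s) =
    (fun t : ℝ => Complex.exp (z * t)) * fun t => ∫ s in (0 : ℝ)..t, h s from rfl, hd, hdef]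
  linear_combination (g : ℝ → ℂ) t * hexp

/-- Over `ℂ` the operator factors into a nonzero constant and first-order operators, each of them
surjective. -/
theorem aeval_derivOp_complex_surjective {p : ℂ[X]} (hp : p ≠ 0) :
    Function.Surjective (aeval (derivOp ℂ) p) := by
  rw [(IsAlgClosed.splits p).eq_prod_roots, map_mul, aeval_C, Module.End.mul_eq_comp,
    LinearMap.coe_comp]
  refine Function.Surjective.comp (fun g => ⟨p.leadingCoeff⁻¹ • g, ?_⟩) ?_
  · simp [Module.algebraMap_end_apply, smul_smul, hp]
  · generalize p.roots = s
    induction s using Multiset.induction_on with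
    | empty => exact fun g => ⟨g, by simp⟩
    | cons z s ih =>
      rw [Multiset.map_cons, Multiset.prod_cons, map_mul, Module.End.mul_eq_comp,
        LinearMap.coe_comp]
      refine Function.Surjective.comp ?_ ih
      simpa using derivOp_sub_algebraMap_surjective z

/-- The real part of a smooth function. -/
noncomputable def smoothRe : smoothFun ℂ →ₗ[ℝ] smoothFun ℝ where
  toFun f := ⟨fun t => ((f : ℝ → ℂ) t).re, Complex.reCLM.contDiff.comp (smoothFun.contDiff f)⟩
  map_add' _ _ := rfl
  map_smul' c f := by ext t; simp

theorem smoothRe_derivOp (f : smoothFun ℂ) :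
    smoothRe (derivOp ℂ f) = derivOp ℝ (smoothRe f) := by
  ext t
  exact (Complex.reCLM.hasFDerivAt.comp_hasDerivAt t
    (smoothFun.differentiable f t).hasDerivAt).deriv.symm

/-- Real coefficients let the real part of a complex solution solve the real equation. -/
theorem smoothRe_aeval (p : ℝ[X]) (f : smoothFun ℂ) :
    smoothRe (aeval (derivOp ℂ) (p.map (algebraMap ℝ ℂ)) f) = aeval (derivOp ℝ) p (smoothRe f) := by
  induction p using Polynomial.induction_on' generalizing f with
  | add p q hp hq =>
    rw [Polynomial.map_add, map_add, map_add, LinearMap.add_apply, LinearMap.add_apply, map_add, hp,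
      hq]
  | monomial n a =>
    simp only [map_monomial, aeval_monomial, Module.End.mul_apply, Module.algebraMap_end_apply]
    have h : smoothRe ((derivOp ℂ ^ n) f) = (derivOp ℝ ^ n) (smoothRe f) := by
      induction n generalizing f with
      | zero => rfl
      | succ n ih => rw [pow_succ, pow_succ, Module.End.mul_apply, Module.End.mul_apply, ih,
          smoothRe_derivOp]
    rw [← h]
    ext t
    change ((a : ℂ) * _).re = a * _
    rw [Complex.re_ofReal_mul]
    rfl

theorem aeval_derivOp_surjective {p : ℝ[X]} (hp : p ≠ 0) :
    Function.Surjective (aeval (derivOp ℝ) p) := by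
  intro g
  obtain ⟨F, hF⟩ := aeval_derivOp_complex_surjective (p := p.map (algebraMap ℝ ℂ))
    (Polynomial.map_ne_zero hp)
    ⟨fun t => ((g : ℝ → ℝ) t : ℂ), Complex.ofRealCLM.contDiff.comp (smoothFun.contDiff g)⟩
  exact ⟨smoothRe F, by rw [← smoothRe_aeval, hF]; rfl⟩

/-! ### Smooth functions as an injective `ℝ[X]`-module -/

/-- Polynomials act on smooth functions as differential operators. -/
noncomputable instance : Module ℝ[X] (smoothFun ℝ) :=
  Module.compHom _ (aeval (R := ℝ) (derivOp ℝ)).toRingHom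

theorem smul_smoothFun_def (p : ℝ[X]) (f : smoothFun ℝ) : p • f = aeval (derivOp ℝ) p f := rfl

theorem smul_smoothFun_apply (p : ℝ[X]) (f : smoothFun ℝ) (t : ℝ) :
    ((p • f : smoothFun ℝ) : ℝ → ℝ) t = diffOp p f t := by
  rw [smul_smoothFun_def, aeval_eq_sum_range, diffOp, sum_over_range _ (by simp)]
  simp [derivOp_pow_apply]

theorem exists_smul_smoothFun_eq {p : ℝ[X]} (hp : p ≠ 0) (g : smoothFun ℝ) :
    ∃ f : smoothFun ℝ, p • f = g :=
  aeval_derivOp_surjective hp g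

/-- A map on the ideal `(r)` is determined by its value at `r`; dividing that value by `r` gives the
image of `1` under an extension. -/
theorem baer_of_forall_exists_smul_eq {R M : Type} [CommRing R] [IsPrincipalIdealRing R]
    [AddCommGroup M] [Module R M] (h : ∀ r : R, r ≠ 0 → ∀ m : M, ∃ x : M, r • x = m) :
    Module.Baer R M := by
  intro I g
  obtain ⟨r, rfl⟩ := (IsPrincipalIdealRing.principal I).principal
  have hr : r ∈ Submodule.span R {r} := Submodule.mem_span_singleton_self r
  obtain ⟨x, hx⟩ : ∃ x : M, r • x = g ⟨r, hr⟩ := by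
    by_cases h0 : r = 0
    · refine ⟨0, ?_⟩
      rw [smul_zero, show (⟨r, hr⟩ : Submodule.span R {r}) = 0 from Subtype.ext h0, map_zero]
    · exact h r h0 _
  refine ⟨LinearMap.toSpanSingleton R M x, fun y hy => ?_⟩
  obtain ⟨a, rfl⟩ := Submodule.mem_span_singleton.1 hy
  rw [LinearMap.toSpanSingleton_apply, smul_assoc, hx, ← map_smul]
  rfl

theorem smoothFun_baer : Module.Baer ℝ[X] (smoothFun ℝ) :=
  baer_of_forall_exists_smul_eq fun _ => exists_smul_smoothFun_eq

/-! ### Behaviors as solution sets of submodules, and elimination -/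

/-- The linear map between free modules that sends the basis vector `a` to the basis vector
`f a`. -/
noncomputable def push {α ι : Type} [Fintype α] [Fintype ι] (f : α → ι) :
    (α → ℝ[X]) →ₗ[ℝ[X]] (ι → ℝ[X]) :=
  (Pi.basisFun ℝ[X] α).constr ℝ[X] fun a => Pi.basisFun ℝ[X] ι (f a)

/-- The signal whose components are the values of `φ` at the standard basis vectors. -/
noncomputable def toSignal {ι : Type} [Fintype ι] (φ : (ι → ℝ[X]) →ₗ[ℝ[X]] smoothFun ℝ) :
    Signal ι :=
  fun t i => (φ (Pi.basisFun ℝ[X] ι i) : ℝ → ℝ) t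

/-- The smooth signals that satisfy all differential equations in `N`. -/
def solutions {ι : Type} [Fintype ι] (N : Submodule ℝ[X] (ι → ℝ[X])) : Behavior ι :=
  {w | ∃ φ : (ι → ℝ[X]) →ₗ[ℝ[X]] smoothFun ℝ, N ≤ LinearMap.ker φ ∧ toSignal φ = w}

section

variable {α ι : Type} [Fintype α] [Fintype ι]

@[simp]
theorem push_basisFun (f : α → ι) (a : α) :
    push f (Pi.basisFun ℝ[X] α a) = Pi.basisFun ℝ[X] ι (f a) :=
  Module.Basis.constr_basis _ _ _ _

theorem push_injective {f : α → ι} (hf : Function.Injective f) : Function.Injective (push f) := by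
  exact Module.Basis.injective_constr_of_linearIndependent _
    ((Pi.basisFun ℝ[X] ι).linearIndependent.comp f hf)

theorem mem_smooth_iff {w : Signal ι} : w ∈ smooth ι ↔ ∀ i, ContDiff ℝ ∞ fun t => w t i :=
  (contDiff_pi : ContDiff ℝ ∞ w ↔ _)

theorem toSignal_injective :
    Function.Injective (toSignal : ((ι → ℝ[X]) →ₗ[ℝ[X]] smoothFun ℝ) → Signal ι) :=
  fun _ _ h => (Pi.basisFun ℝ[X] ι).ext fun i => Subtype.ext <| funext fun t =>
    congrFun (congrFun h t) i

theorem toSignal_mem_smooth (φ : (ι → ℝ[X]) →ₗ[ℝ[X]] smoothFun ℝ) : toSignal φ ∈ smooth ι :=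
  mem_smooth_iff.2 fun i => smoothFun.contDiff (φ (Pi.basisFun ℝ[X] ι i))

theorem exists_toSignal_eq {w : Signal ι} (hw : w ∈ smooth ι) : ∃ φ, toSignal φ = w := by
  refine ⟨(Pi.basisFun ℝ[X] ι).constr ℝ[X] fun i => (⟨fun t => w t i, mem_smooth_iff.1 hw i⟩ :
    smoothFun ℝ), ?_⟩
  ext t i
  rw [toSignal, Module.Basis.constr_basis]

@[simp]
theorem toSignal_mem_solutions {N : Submodule ℝ[X] (ι → ℝ[X])}
    {φ : (ι → ℝ[X]) →ₗ[ℝ[X]] smoothFun ℝ} : toSignal φ ∈ solutions N ↔ N ≤ LinearMap.ker φ :=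
  ⟨fun ⟨_, hψ, h⟩ => toSignal_injective h ▸ hψ, fun h => ⟨φ, h, rfl⟩⟩

theorem solutions_subset_smooth (N : Submodule ℝ[X] (ι → ℝ[X])) : solutions N ⊆ smooth ι := by
  rintro _ ⟨φ, -, rfl⟩
  exact toSignal_mem_smooth φ

theorem select_toSignal (f : α → ι) (φ : (ι → ℝ[X]) →ₗ[ℝ[X]] smoothFun ℝ) :
    select f (toSignal φ) = toSignal (φ ∘ₗ push f) := by
  ext t a
  simp [select, toSignal]

theorem sum_diffOp_toSignal (r : ι → ℝ[X]) (φ : (ι → ℝ[X]) →ₗ[ℝ[X]] smoothFun ℝ) (t : ℝ) :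
    ∑ j, diffOp (r j) (fun τ => toSignal φ τ j) t = (φ r : ℝ → ℝ) t := by
  conv_rhs => rw [← (Pi.basisFun ℝ[X] ι).sum_repr r]
  simp [-Pi.basisFun_apply, smul_smoothFun_apply, toSignal]

theorem kernelBehavior_eq_solutions {g : ℕ} (R : Matrix (Fin g) ι ℝ[X]) :
    kernelBehavior R = solutions (Submodule.span ℝ[X] (Set.range R)) := by
  ext w
  constructor
  · rintro ⟨hw, h⟩
    obtain ⟨φ, rfl⟩ := exists_toSignal_eq hw
    rw [toSignal_mem_solutions, Submodule.span_le]
    rintro _ ⟨i, rfl⟩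
    exact Subtype.ext <| funext fun t => by rw [← sum_diffOp_toSignal, h]; rfl
  · rintro ⟨φ, hφ, rfl⟩
    refine ⟨toSignal_mem_smooth φ, fun i t => ?_⟩
    rw [sum_diffOp_toSignal, LinearMap.mem_ker.1 (hφ (Submodule.subset_span ⟨i, rfl⟩))]
    rfl

theorem isLinearDifferential_solutions (N : Submodule ℝ[X] (ι → ℝ[X])) :
    IsLinearDifferential (solutions N) := by
  obtain ⟨g, R, hR⟩ := Submodule.fg_iff_exists_fin_generating_family.1
    (IsNoetherian.noetherian N)
  -- The added zero row keeps the number of rows positive when the generating family is empty.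
  refine ⟨g + 1, g.succ_pos, Matrix.of (Fin.cons 0 R), ?_⟩
  have h := kernelBehavior_eq_solutions (Matrix.of (Fin.cons 0 R))
  rw [show Set.range (Matrix.of (Fin.cons 0 R)) = insert 0 (Set.range R) from Fin.range_cons _ _,
    Submodule.span_insert_zero, hR] at h
  exact h.symm

theorem isLinearDifferential_iff {B : Behavior ι} :
    IsLinearDifferential B ↔ ∃ N, B = solutions N := by
  constructor
  · rintro ⟨g, -, R, rfl⟩
    exact ⟨_, kernelBehavior_eq_solutions R⟩
  · rintro ⟨N, rfl⟩
    exact isLinearDifferential_solutions N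

/-- The elimination theorem. The contraction is chosen so that `push f` induces an injection of
quotient modules; a solution on the smaller quotient then extends because `C^∞` is injective. -/
theorem manifest_solutions (f : α → ι) (N : Submodule ℝ[X] (ι → ℝ[X])) :
    manifest f (solutions N) = solutions (N.comap (push f)) := by
  ext v
  constructor
  · rintro ⟨_, ⟨φ, hφ, rfl⟩, rfl⟩
    rw [select_toSignal, toSignal_mem_solutions]
    exact fun r hr => hφ hr
  · rintro ⟨ψ, hψ, rfl⟩
    obtain ⟨θ, hθ⟩ := Module.Baer.extension_property smoothFun_baer
      (Submodule.mapQ (N.comap (push f)) N (push f) le_rfl)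
      (LinearMap.ker_eq_bot.1 (by rw [Submodule.ker_mapQ, Submodule.mkQ_map_self]))
      (Submodule.liftQ _ ψ hψ)
    refine ⟨toSignal (θ ∘ₗ N.mkQ), ⟨_, ?_, rfl⟩, ?_⟩
    · exact fun r hr => by simp [(Submodule.Quotient.mk_eq_zero N).2 hr]
    · rw [select_toSignal]
      congr 1
      ext1 r
      simpa using LinearMap.congr_fun hθ (Submodule.Quotient.mk r)

theorem select_mem_solutions_iff (f : α → ι) (N : Submodule ℝ[X] (α → ℝ[X]))
    {x : Signal ι} (hx : x ∈ smooth ι) :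
    select f x ∈ solutions N ↔ x ∈ solutions (N.map (push f)) := by
  obtain ⟨φ, rfl⟩ := exists_toSignal_eq hx
  rw [select_toSignal, toSignal_mem_solutions, toSignal_mem_solutions,
    Submodule.map_le_iff_le_comap]
  rfl

theorem mem_solutions_sup {N N' : Submodule ℝ[X] (ι → ℝ[X])} {x : Signal ι} :
    x ∈ solutions (N ⊔ N') ↔ x ∈ solutions N ∧ x ∈ solutions N' := by
  constructor
  · rintro ⟨φ, h, rfl⟩
    simpa using h
  · rintro ⟨⟨φ, h, rfl⟩, h'⟩
    simp_all

theorem mem_solutions_iSup {κ : Type} {N : κ → Submodule ℝ[X] (ι → ℝ[X])} {x : Signal ι}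
    (hx : x ∈ smooth ι) : x ∈ solutions (⨆ k, N k) ↔ ∀ k, x ∈ solutions (N k) := by
  obtain ⟨φ, rfl⟩ := exists_toSignal_eq hx
  simp

/-- A row `r` with `r j ≠ 0` is violated by some smooth signal: take `u` with `r j • u = 1` in
component `j` and zero elsewhere. -/
theorem smooth_subset_solutions_iff {N : Submodule ℝ[X] (ι → ℝ[X])} :
    smooth ι ⊆ solutions N ↔ N = ⊥ := by
  classical
  constructor
  · refine fun h => (Submodule.eq_bot_iff N).2 fun r hr => by_contra fun h0 => ?_
    obtain ⟨j, hj⟩ := Function.ne_iff.1 h0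
    obtain ⟨u, hu⟩ := exists_smul_smoothFun_eq hj
      ⟨fun _ => 1, (contDiff_const : ContDiff ℝ ∞ fun _ : ℝ => (1 : ℝ))⟩
    have h1 := toSignal_mem_solutions.1
      (h (toSignal_mem_smooth ((LinearMap.toSpanSingleton ℝ[X] _ u) ∘ₗ LinearMap.proj j))) hr
    rw [LinearMap.mem_ker, LinearMap.comp_apply, LinearMap.proj_apply,
      LinearMap.toSpanSingleton_apply, hu] at h1
    exact one_ne_zero (congrFun (congrArg Subtype.val h1) 0)
  · rintro rfl w hw
    obtain ⟨φ, rfl⟩ := exists_toSignal_eq hw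
    simp

theorem IsLinearDifferential.subset_smooth {B : Behavior ι} (hB : IsLinearDifferential B) :
    B ⊆ smooth ι :=
  let ⟨_, _, _, h⟩ := hB
  h ▸ fun _ hx => hx.1

theorem IsLinearDifferential.manifest {B : Behavior ι} (hB : IsLinearDifferential B)
    (f : α → ι) : IsLinearDifferential (manifest f B) := by
  obtain ⟨N, rfl⟩ := isLinearDifferential_iff.1 hB
  exact manifest_solutions f N ▸ isLinearDifferential_solutions _

theorem IsLinearDifferential.sub_mem {B : Behavior ι} (hB : IsLinearDifferential B)
    {x y : Signal ι} (hx : x ∈ B) (hy : y ∈ B) : x - y ∈ B := by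
  obtain ⟨N, rfl⟩ := isLinearDifferential_iff.1 hB
  obtain ⟨φ, hφ, rfl⟩ := hx
  obtain ⟨ψ, hψ, rfl⟩ := hy
  refine ⟨φ - ψ, fun r hr => ?_, rfl⟩
  rw [LinearMap.mem_ker, LinearMap.sub_apply, LinearMap.mem_ker.1 (hφ hr),
    LinearMap.mem_ker.1 (hψ hr), sub_zero]

theorem IsLinearDifferential.add_mem {B : Behavior ι} (hB : IsLinearDifferential B)
    {x y : Signal ι} (hx : x ∈ B) (hy : y ∈ B) : x + y ∈ B := by
  -- This is `x - ((x - x) - y)`, so closure under subtraction suffices.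
  have h := hB.sub_mem hx (hB.sub_mem (hB.sub_mem hx hx) hy)
  simpa using h

/-- The covering condition `hf` forces every component of `x` to be smooth; a component seen by no
`f k` would be an arbitrary function. -/
theorem IsLinearDifferential.setOf_forall_select_mem {κ : Type} {β : κ → Type}
    [∀ k, Fintype (β k)] {B : ∀ k, Behavior (β k)} (hB : ∀ k, IsLinearDifferential (B k))
    (f : ∀ k, β k → ι) (hf : ∀ a, ∃ k b, f k b = a) :
    IsLinearDifferential {x : Signal ι | ∀ k, select (f k) x ∈ B k} := by
  choose N hN using fun k => isLinearDifferential_iff.1 (hB k)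
  refine isLinearDifferential_iff.2 ⟨⨆ k, (N k).map (push (f k)), ?_⟩
  ext x
  have key (hx : x ∈ smooth ι) :
      (∀ k, select (f k) x ∈ B k) ↔ x ∈ solutions (⨆ k, (N k).map (push (f k))) := by
    rw [mem_solutions_iSup hx]
    exact forall_congr' fun k => by rw [hN, select_mem_solutions_iff _ _ hx]
  constructor
  · refine fun h => (key (mem_smooth_iff.2 fun a => ?_)).1 h
    obtain ⟨k, b, rfl⟩ := hf a
    exact mem_smooth_iff.1 ((hB k).subset_smooth (h k)) b
  · exact fun h => (key (solutions_subset_smooth _ h)).2 h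

end

/-! ### Free variables, output cardinality and regularity -/

section

variable {ι : Type} [Fintype ι]

/-- The classes of the standard basis vectors modulo the equations `N`. -/
noncomputable def variableClass (N : Submodule ℝ[X] (ι → ℝ[X])) (i : ι) : (ι → ℝ[X]) ⧸ N :=
  N.mkQ (Pi.basisFun ℝ[X] ι i)

theorem isFree_solutions_iff_comap {N : Submodule ℝ[X] (ι → ℝ[X])} {I : Finset ι} :
    IsFree (solutions N) I ↔ N.comap (push fun i : I => (i : ι)) = ⊥ := by
  rw [← smooth_subset_solutions_iff, ← manifest_solutions]
  rfl

/-- Components are free when `N` imposes no nontrivial equation on them alone, which is a linear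
independence condition modulo `N`. -/
theorem isFree_solutions_iff {N : Submodule ℝ[X] (ι → ℝ[X])} {I : Finset ι} :
    IsFree (solutions N) I ↔ LinearIndepOn ℝ[X] (variableClass N) (I : Set ι) := by
  have hker : N.comap (push fun i : I => (i : ι)) =
      LinearMap.ker (N.mkQ ∘ₗ push fun i : I => (i : ι)) := by
    rw [LinearMap.ker_comp, Submodule.ker_mkQ]
  rw [isFree_solutions_iff_comap, hker]
  constructor
  · intro h
    have h' := (LinearMap.linearIndependent_iff _ h).2 (Pi.basisFun ℝ[X] I).linearIndependent
    have hcomp : (N.mkQ ∘ₗ push fun i : I => (i : ι)) ∘ Pi.basisFun ℝ[X] I =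
        fun i : I => variableClass N i := by
      ext1 i
      simp [variableClass, -Pi.basisFun_apply]
    rwa [hcomp] at h'
  · intro h
    rw [LinearMap.ker_eq_bot]
    convert Module.Basis.injective_constr_of_linearIndependent (R₂ := ℝ[X])
      (Pi.basisFun ℝ[X] I) h using 2
    refine (Pi.basisFun ℝ[X] I).ext fun i => ?_
    rw [Module.Basis.constr_basis]
    simp [variableClass, -Pi.basisFun_apply]

theorem span_range_variableClass (N : Submodule ℝ[X] (ι → ℝ[X])) :
    Submodule.span ℝ[X] (Set.range (variableClass N)) = ⊤ := by
  rw [show variableClass N = N.mkQ ∘ Pi.basisFun ℝ[X] ι from rfl, Set.range_comp,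
    Submodule.span_image, (Pi.basisFun ℝ[X] ι).span_eq, Submodule.map_top, Submodule.range_mkQ]

end

/-- A maximal linearly independent subfamily of a finite generating family has as many members as
the rank. -/
theorem card_eq_finrank_of_maximal_linearIndepOn {R M ι : Type} [CommRing R] [IsDomain R]
    [AddCommGroup M] [Module R M] [Module.Finite R M] {v : ι → M}
    (hv : Submodule.span R (Set.range v) = ⊤) {I : Finset ι}
    (hI : Maximal (fun J : Finset ι => LinearIndepOn R v (J : Set ι)) I) :
    I.card = Module.finrank R M := by
  classical
  set U := Submodule.span R (v '' (I : Set ι)) with hU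
  -- By maximality each generator is torsion modulo `U`: otherwise its index could be adjoined to
  -- `I`. Hence `M ⧸ U` has rank zero.
  have htors (i : ι) : U.mkQ (v i) ∈ Submodule.torsion R (M ⧸ U) := by
    by_contra hi
    have hiI : i ∉ I := fun h => hi <| by
      have h0 : U.mkQ (v i) = 0 :=
        (Submodule.Quotient.mk_eq_zero _).2 (Submodule.subset_span ⟨i, h, rfl⟩)
      rw [h0]
      exact Submodule.zero_mem _
    have hsing : LinearIndepOn R (U.mkQ ∘ v) {i} := by
      refine linearIndepOn_iff'.2 fun t g ht hg j hj => by_contra fun hgj => hi ?_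
      have hti : t = {i} := by
        obtain rfl : j = i := ht hj
        exact Finset.eq_singleton_iff_unique_mem.2 ⟨hj, fun k hk => ht hk⟩
      subst hti
      obtain rfl := Finset.mem_singleton.1 hj
      rw [Finset.sum_singleton] at hg
      exact (Submodule.mem_torsion_iff _).2 ⟨⟨g j, mem_nonZeroDivisors_of_ne_zero hgj⟩, hg⟩
    have hins := hI.prop.union_of_quotient hsing
    rw [← Finset.coe_singleton, ← Finset.coe_union] at hins
    exact hiI (hI.le_of_ge hins Finset.subset_union_left
      (Finset.mem_union_right _ (Finset.mem_singleton_self i)))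
  have htop : Submodule.torsion R (M ⧸ U) = ⊤ := by
    rw [eq_top_iff, ← Submodule.range_mkQ U, ← Submodule.map_top, ← hv, Submodule.map_span_le]
    rintro _ ⟨i, rfl⟩
    exact htors i
  have h0 : Module.finrank R (M ⧸ U) = 0 := by
    rw [Module.finrank_eq_zero_iff_isTorsion]
    exact Submodule.isTorsion'_iff_torsion'_eq_top _ |>.2 htop
  rw [← U.finrank_quotient_add_finrank, h0, zero_add, hU, Set.image_eq_range]
  exact ((finrank_span_eq_card hI.prop.linearIndependent).trans (by simp)).symm

/-- Every maximal free set has as many elements as the rank of the quotient by `N`, so the outputs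
number the rank of `N` whichever partition is used. -/
theorem outputCard_solutions {ι : Type} [Fintype ι] (N : Submodule ℝ[X] (ι → ℝ[X])) :
    outputCard (solutions N) = Module.finrank ℝ[X] N := by
  have hrank := N.finrank_quotient_add_finrank
  rw [Module.finrank_fintype_fun_eq_card] at hrank
  have hfree : IsFree (solutions N) =
      fun J : Finset ι => LinearIndepOn ℝ[X] (variableClass N) (J : Set ι) :=
    funext fun J => propext isFree_solutions_iff
  have hcard {I : Finset ι} (hI : IsInputOutputPartition (solutions N) I) :
      Fintype.card ι - I.card = Module.finrank ℝ[X] N := by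
    rw [card_eq_finrank_of_maximal_linearIndepOn (span_range_variableClass N)
      (hfree ▸ hI)]
    omega
  obtain ⟨I, hI⟩ : ∃ I, IsInputOutputPartition (solutions N) I :=
    (Set.toFinite {I | IsFree (solutions N) I}).exists_maximal
      ⟨∅, isFree_solutions_iff.2 (by simp)⟩
  rw [outputCard, show {p | ∃ I : Finset ι, IsInputOutputPartition (solutions N) I ∧
    p = Fintype.card ι - I.card} = {Module.finrank ℝ[X] N} from ?_, csInf_singleton]
  ext p
  exact ⟨fun ⟨J, hJ, hp⟩ => hp.trans (hcard hJ), fun hp => ⟨I, hI, hp.trans (hcard hI).symm⟩⟩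

theorem finrank_sup_of_disjoint {R M : Type} [CommRing R] [IsDomain R] [IsNoetherianRing R]
    [AddCommGroup M] [Module R M] [Module.Finite R M] {N N' : Submodule R M} (h : Disjoint N N') :
    Module.finrank R (N ⊔ N' : Submodule R M) = Module.finrank R N + Module.finrank R N' := by
  have := Submodule.rank_sup_add_rank_inf_eq N N'
  rw [h.eq_bot, rank_bot, add_zero] at this
  simp only [← Module.finrank_eq_rank] at this
  exact_mod_cast this

/-- If the control variable is free in the plant, then the interconnection through the control
variable with any linear differential controller is regular. -/
theorem isRegularInterconnection_of_smooth_subset_manifest {ν γ : Type} [Fintype ν] [Fintype γ]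
    {P : Behavior (ν ⊕ γ)} {C : Behavior γ} (hP : IsLinearDifferential P)
    (hC : IsLinearDifferential C) (hfree : smooth γ ⊆ manifest Sum.inr P) :
    IsRegularInterconnection P C := by
  refine ⟨hP, hC, ?_⟩
  obtain ⟨N, rfl⟩ := isLinearDifferential_iff.1 hP
  obtain ⟨N', rfl⟩ := isLinearDifferential_iff.1 hC
  rw [manifest_solutions, smooth_subset_solutions_iff] at hfree
  have hctrl : controlledBy (solutions N) (solutions N') =
      solutions (N ⊔ N'.map (push Sum.inr)) := by
    ext x
    rw [mem_solutions_sup]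
    exact and_congr_right fun hx => select_mem_solutions_iff _ _ (solutions_subset_smooth _ hx)
  -- By `hfree`, an element of `N` supported on the control variables vanishes.
  have hdisj : Disjoint N (N'.map (push Sum.inr)) := by
    rw [Submodule.disjoint_def]
    rintro _ hx ⟨r, -, rfl⟩
    rw [(Submodule.eq_bot_iff _).1 hfree r hx, map_zero]
  rw [hctrl, outputCard_solutions, outputCard_solutions, outputCard_solutions,
    finrank_sup_of_disjoint hdisj,
    ← (Submodule.equivMapOfInjective (push Sum.inr) (push_injective Sum.inr_injective)
      N').finrank_eq]

/-! ### Networks and the canonical distributed controller -/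

section

variable {L : ℕ} {W C : Fin L → Type} {S K Q : Link L → Type}

theorem exists_linkIncl_eq (a : LinkVar S) : ∃ i b, linkIncl S i b = a := by
  obtain ⟨⟨e, he⟩, s⟩ := a
  induction e with
  | h i j => exact ⟨i, ⟨⟨⟨s(i, j), he⟩, Sym2.mem_mk_left i j⟩, s⟩, rfl⟩

theorem networkExt_subset_manifest_closedLoop
    {P : ∀ i, Behavior (W i ⊕ LocalLinkVar S i ⊕ C i)} {Kd : ∀ i, Behavior (W i ⊕ LocalLinkVar K i)}
    (hKP : networkExt Kd ⊆ plantW P) :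
    networkExt Kd ⊆
      manifest (fun a => Sum.inl (Sum.inl a)) (closedLoop P (canonicalController P Kd)) := by
  rintro _ ⟨y, hy, rfl⟩
  obtain ⟨x, hx, hxy⟩ := hKP ⟨y, hy, rfl⟩
  -- The controller's `s` is copied from the plant trajectory `x` and its `k` from the desired
  -- trajectory `y`. Each local controller then accepts, with the plant's own `w_i` as internal
  -- signal.
  refine ⟨fun t => Sum.elim (x t) fun a => Sum.elim (fun s => x t (Sum.inr (Sum.inl ⟨a.1, s⟩)))
    (fun k => y t (Sum.inr ⟨a.1, k⟩)) a.2, ⟨hx, fun i => ?_⟩, hxy⟩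
  refine ⟨fun t => Sum.elim
      (fun b => x t (Sum.map (Sigma.mk i) (Sum.map (linkIncl S i) (Sigma.mk i)) b))
      (fun k => y t (Sum.inr (linkIncl K i k))), ⟨hx i, ?_⟩, ?_⟩
  · convert hy i using 1
    ext t (a | a)
    · exact congrFun (congrFun hxy t) ⟨i, a⟩
    · rfl
  · ext t (a | ⟨e, a | a⟩) <;> rfl

variable [∀ i, Fintype (W i)] [∀ i, Fintype (C i)] [∀ e, Fintype (S e)] [∀ e, Fintype (K e)]
  [∀ e, Fintype (Q e)]

theorem isLinearDifferential_plantNetwork {P : ∀ i, Behavior (W i ⊕ LocalLinkVar S i ⊕ C i)}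
    (hP : ∀ i, IsLinearDifferential (P i)) : IsLinearDifferential (plantNetwork P) := by
  refine IsLinearDifferential.setOf_forall_select_mem hP _ ?_
  rintro (⟨i, a⟩ | a | ⟨i, a⟩)
  · exact ⟨i, Sum.inl a, rfl⟩
  · obtain ⟨i, b, rfl⟩ := exists_linkIncl_eq a
    exact ⟨i, Sum.inr (Sum.inl b), rfl⟩
  · exact ⟨i, Sum.inr (Sum.inr a), rfl⟩

theorem isLinearDifferential_network {B : ∀ i, Behavior (C i ⊕ LocalLinkVar Q i)}
    (hB : ∀ i, IsLinearDifferential (B i)) : IsLinearDifferential (network B) := by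
  refine IsLinearDifferential.setOf_forall_select_mem hB _ ?_
  rintro (⟨i, a⟩ | a)
  · exact ⟨i, Sum.inl a, rfl⟩
  · obtain ⟨i, b, rfl⟩ := exists_linkIncl_eq a
    exact ⟨i, Sum.inr b, rfl⟩

theorem isLinearDifferential_localInterconnection {i : Fin L}
    {Pi : Behavior (W i ⊕ LocalLinkVar S i ⊕ C i)} {Ki : Behavior (W i ⊕ LocalLinkVar K i)}
    (hP : IsLinearDifferential Pi) (hK : IsLinearDifferential Ki) :
    IsLinearDifferential (localInterconnection Pi Ki) := by
  obtain ⟨N, rfl⟩ := isLinearDifferential_iff.1 hP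
  obtain ⟨N', rfl⟩ := isLinearDifferential_iff.1 hK
  refine isLinearDifferential_iff.2 ⟨N.map (push Sum.inl) ⊔ N'.map (push (Sum.map Sum.inl id)), ?_⟩
  ext x
  rw [mem_solutions_sup]
  constructor
  · rintro ⟨h, h'⟩
    have hx : x ∈ smooth ((W i ⊕ LocalLinkVar S i ⊕ C i) ⊕ LocalLinkVar K i) := by
      rw [mem_smooth_iff]
      rintro (a | a)
      · exact mem_smooth_iff.1 (solutions_subset_smooth _ h) a
      · exact mem_smooth_iff.1 (solutions_subset_smooth _ h') (Sum.inr a)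
    exact ⟨(select_mem_solutions_iff _ _ hx).1 h, (select_mem_solutions_iff _ _ hx).1 h'⟩
  · rintro ⟨h, h'⟩
    have hx := solutions_subset_smooth _ h
    exact ⟨(select_mem_solutions_iff _ _ hx).2 h, (select_mem_solutions_iff _ _ hx).2 h'⟩

theorem isLinearDifferential_canonicalController
    {P : ∀ i, Behavior (W i ⊕ LocalLinkVar S i ⊕ C i)} {Kd : ∀ i, Behavior (W i ⊕ LocalLinkVar K i)}
    (hP : ∀ i, IsLinearDifferential (P i)) (hK : ∀ i, IsLinearDifferential (Kd i)) (i : Fin L) :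
    IsLinearDifferential (canonicalController P Kd i) :=
  (isLinearDifferential_localInterconnection (hP i) (hK i)).manifest _

theorem manifest_closedLoop_subset_networkExt
    {P : ∀ i, Behavior (W i ⊕ LocalLinkVar S i ⊕ C i)} {Kd : ∀ i, Behavior (W i ⊕ LocalLinkVar K i)}
    (hP : ∀ i, IsLinearDifferential (P i)) (hK : ∀ i, IsLinearDifferential (Kd i))
    (hN : hidden P ⊆ networkExt Kd) :
    manifest (fun a => Sum.inl (Sum.inl a)) (closedLoop P (canonicalController P Kd)) ⊆
      networkExt Kd := by
  rintro _ ⟨x, ⟨hxP, hxD⟩, rfl⟩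
  choose z hz hzx using hxD
  have hzx' (i : Fin L) (t : ℝ) b := congrFun (congrFun (hzx i) t) b
  -- the signals `w'` of the local controllers, with the shared variables of the controller
  let w' : Signal (Σ i, W i) := fun t a => z a.1 t (Sum.inl (Sum.inl a.2))
  let y : Signal ((Σ i, W i) ⊕ LinkVar S ⊕ (Σ i, C i)) := fun t =>
    Sum.elim (w' t) (Sum.elim (fun a => x t (Sum.inr ⟨a.1, Sum.inl a.2⟩))
      (fun a => x t (Sum.inl (Sum.inr (Sum.inr a)))))
  -- The locally chosen `w'_i` fit together because the local controllers share one `s`; sharing one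
  -- `k` gives `hw'` in the same way.
  have hy : y ∈ plantNetwork P := fun i => by
    convert (hz i).1 using 1
    ext t (a | ⟨e, a⟩ | a)
    · rfl
    · exact (hzx' i t (Sum.inr ⟨e, Sum.inl a⟩)).symm
    · exact (hzx' i t (Sum.inl a)).symm
  have hw' : w' ∈ networkExt Kd := by
    refine ⟨fun t => Sum.elim (w' t) fun a => x t (Sum.inr ⟨a.1, Sum.inr a.2⟩), fun i => ?_, rfl⟩
    convert (hz i).2 using 1
    ext t (a | ⟨e, a⟩)
    · rfl
    · exact (hzx' i t (Sum.inr ⟨e, Sum.inr a⟩)).symm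
  -- The two plant trajectories agree in `c` but possibly not in `s`; membership in `hidden P`
  -- constrains only `c`.
  have hdiff : select (fun a => Sum.inl (Sum.inl a)) x - w' ∈ networkExt Kd := by
    refine hN ⟨select Sum.inl x - y, (isLinearDifferential_plantNetwork hP).sub_mem hxP hy, ?_⟩
    ext t (a | a)
    · rfl
    · exact sub_self _
  have h := ((isLinearDifferential_network hK).manifest Sum.inl).add_mem hdiff hw'
  rwa [sub_add_cancel] at h

end

end Behavioral

theorem mainTheorem6 (L : ℕ) (W C : Fin L → Type) (S K : Behavioral.Link L → Type)
    [∀ i, Fintype (W i)] [∀ i, Fintype (C i)] [∀ e, Fintype (S e)] [∀ e, Fintype (K e)]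
    (P : ∀ i, Behavioral.Behavior (W i ⊕ Behavioral.LocalLinkVar S i ⊕ C i))
    (Kd : ∀ i, Behavioral.Behavior (W i ⊕ Behavioral.LocalLinkVar K i))
    (hP : ∀ i, Behavioral.IsLinearDifferential (P i))
    (hK : ∀ i, Behavioral.IsLinearDifferential (Kd i))
    (hN : Behavioral.hidden P ⊆ Behavioral.networkExt Kd)
    (hKP : Behavioral.networkExt Kd ⊆ Behavioral.plantW P)
    (hc : Behavioral.plantC P = Behavioral.smooth (Σ i, C i)) :
    Behavioral.Implements (Behavioral.canonicalController P Kd) P Kd ∧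
      Behavioral.IsRegularWrtC (Behavioral.canonicalController P Kd) P := by
  have hD := Behavioral.isLinearDifferential_canonicalController hP hK
  refine ⟨⟨hD, (Behavioral.networkExt_subset_manifest_closedLoop hKP).antisymm
    (Behavioral.manifest_closedLoop_subset_networkExt hP hK hN)⟩,
    Behavioral.isRegularInterconnection_of_smooth_subset_manifest
      ((Behavioral.isLinearDifferential_plantNetwork hP).manifest _)
      ((Behavioral.isLinearDifferential_network hD).manifest _) ?_⟩
  -- Freeness of `c` in the full plant passes to the plant with `s` eliminated.
  rw [← hc]
  rintro _ ⟨x, hx, rfl⟩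
  exact ⟨_, ⟨x, hx, rfl⟩, rfl⟩
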